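/- Equip $[0,1]$ and $(0,\infty)$ with Lebesgue measure $\lambda$. For real random variables $f_1,\dots,f_n$ on $[0,1]$ let $F=\sum_{k=1}^n \bar f_k$ be their disjointification, where $\bar f_1,\dots,\bar f_n$ are disjointly supported functions on $(0,\infty)$ such that $\bar f_k$ is an equimeasurable copy of $f_k$, i.e. $\lambda\{\bar f_k\in B\}=\lambda\{f_k\in B\}$ for every Borel set $B\subset\mathbb{R}\setminus\{0\}$. Let $F^*(t)=\inf\{\tau\ge 0:\lambda\{|F|>\tau\}\le t\}$ be the decreasing rearrangement of $|F|$. For $1\le p<\infty$, call $C>0$ admissible for $p$ if Rosenthal's inequality $$\Bigl\|\sum_{k=1}^n f_k\Bigr\|_{L_p[0,1]}\le C\Bigl(\bigl\|F^*\chi_{[0,1]}\bigr\|_{L_p}+\bigl\|F^*\chi_{[1,\infty)}\bigr\|_{L_1}\Bigr)$$ holds for every $n\in\mathbb{N}$ and all independent random variables $f_1,\dots,f_n\in L_p[0,1]$. Then the constant of order $p/\ln(p+1)$ in Rosenthal's inequality is optimal: there are universal constants $\alpha,\beta>0$ such that for every $p\in[1,\infty)$ the constant $\beta\,\frac{p}{\ln(p+1)}$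 is admissible for $p$, and every $C$ that is admissible for $p$ satisfies $C\ge\alpha\,\frac{p}{\ln(p+1)}$. -/

import Mathlib

open MeasureTheory ProbabilityTheory Set
open scoped ENNReal unitInterval

/-- The decreasing rearrangement `f*(t) = inf {τ ≥ 0 : μ {|f| > τ} ≤ t}` of `|f|`, for a function
`f` on a measure space `(Ω, μ)` and `t ≥ 0`, as an element of `[0, ∞]`. -/
noncomputable def decRearrangement {Ω : Type*} [MeasurableSpace Ω] (μ : Measure Ω) (f : Ω → ℝ)
    (t : ℝ) : ℝ≥0∞ :=
  sInf {τ : ℝ≥0∞ | μ {x | τ < ‖f x‖ₑ} ≤ ENNReal.ofReal t}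

/-- `g 0, …, g (n-1)`, functions on the half-line `(0, ∞)` (values elsewhere are ignored), are
disjointly supported equimeasurable copies of the functions `f 0, …, f (n-1)` on `[0, 1]`.
The set `s` has to avoid `0` because `(0, ∞)` has infinite measure. -/
structure IsDisjointCopies {n : ℕ} (f : Fin n → I → ℝ) (g : Fin n → ℝ → ℝ) : Prop where
  aemeasurable : ∀ k, AEMeasurable (g k) (volume.restrict (Ioi 0))
  disjoint : ∀ i j, i ≠ j →
    Disjoint (Function.support (g i) ∩ Ioi 0) (Function.support (g j) ∩ Ioi 0)
  equimeasurable : ∀ k, ∀ s : Set ℝ, MeasurableSet s → (0 : ℝ) ∉ s →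
    (volume.restrict (Ioi 0)) (g k ⁻¹' s) = volume (f k ⁻¹' s)

/-- `‖F* χ_[0,1]‖_{L_p} + ‖F* χ_[1,∞)‖_{L_1}` for a function `F` on `(0, ∞)`. -/
noncomputable def rosenthalNorm (p : ℝ) (F : ℝ → ℝ) : ℝ≥0∞ :=
  eLpNorm (decRearrangement (volume.restrict (Ioi 0)) F) (ENNReal.ofReal p)
      (volume.restrict (Icc 0 1)) +
    eLpNorm (decRearrangement (volume.restrict (Ioi 0)) F) 1 (volume.restrict (Ici 1))

/-- `C > 0` is an admissible constant in Rosenthal's inequality in `L_p[0,1]`: for every `n` and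
all independent random variables `f 0, …, f (n-1)` in `L_p[0,1]`, with disjointification `F`,
`‖∑ f_k‖_p ≤ C (‖F* χ_[0,1]‖_p + ‖F* χ_[1,∞)‖_1)`. -/
def IsRosenthalConstant (p C : ℝ) : Prop :=
  0 < C ∧ ∀ (n : ℕ) (f : Fin n → I → ℝ) (g : Fin n → ℝ → ℝ),
    (∀ k, MemLp (f k) (ENNReal.ofReal p) volume) →
    iIndepFun f volume →
    IsDisjointCopies f g →
    eLpNorm (fun x => ∑ k, f k x) (ENNReal.ofReal p) volume ≤
      ENNReal.ofReal C * rosenthalNorm p (fun u => ∑ k, g k u)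

/-!
The Rosenthal norm `M` of the disjointification `F` dominates two moments of the independent
variables `f k`: `∑ E |f k| ≤ M` and `∑ E |f k| ^ p ≤ M ^ p`. Indeed these sums are `∫ F*` and
`∫ (F*) ^ p` over `(0, ∞)`, since `F*` is equimeasurable with `|F|` and the distribution function
of `F` is the sum of those of the `f k`
(`IsDisjointCopies.lintegral_decRearrangement_rpow`); beyond `t = 1` the function `F*` is bounded
by `F*(1)`, which is at most the `L_p` norm of `F*` over `[0, 1]`
(`Antitone.lintegral_Ioi_le_and_lintegral_rpow_Ioi_le`).

After normalising to `M = 1`, the upper bound is an argument of Latała. With `r = log (p + 1) / p`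
one has `(1 + r) ^ p ≤ p + 1`, hence `(1 + r x) ^ p ≤ 1 + p x + (p + 1) x ^ p` for all `x ≥ 0`
(`rpow_one_add_mul_le`). By independence,
`E (r ∑ |f k|) ^ p ≤ ∏ E (1 + r |f k|) ^ p ≤ exp (p + (p + 1)) ≤ exp (3 p)`
(`lintegral_rpow_mul_sum_le`), so `exp 3 * p / log (p + 1)` is admissible.

For the lower bound take `m = ⌊p / log (p + 1)⌋` independent events of probability `1 / m`. The
disjointification of their indicators is the indicator of `(0, 1]`, of Rosenthal norm one, whereas
all events occur together with probability `m ^ (-m) ≥ exp (-p)`, so the `L_p` norm of the sum is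
at least `m / e` (`IsRosenthalConstant.rpow_mul_pow_le`, `IsRosenthalConstant.le`).
-/

/-! ### Distribution of the decreasing rearrangement -/

/-- The infimum defining the decreasing rearrangement is attained, since `τ ↦ μ {τ < |F|}` is
right-continuous. No measurability is needed: continuity of measure along increasing unions holds
for arbitrary sets. -/
theorem decRearrangement_le_iff {Ω : Type*} [MeasurableSpace Ω] (μ : Measure Ω) (F : Ω → ℝ) (t : ℝ)
    (τ : ℝ≥0∞) :
    decRearrangement μ F t ≤ τ ↔ μ {x | τ < ‖F x‖ₑ} ≤ ENNReal.ofReal t := by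
  refine ⟨fun h => ?_, fun h => sInf_le h⟩
  rcases eq_or_ne τ ⊤ with rfl | hτ
  · simp
  -- Approximating `τ` strictly from above exhausts `{τ < |F|}` from inside.
  obtain ⟨u, hu, hlt, hlim⟩ := exists_seq_strictAnti_tendsto' (lt_top_iff_ne_top.2 hτ)
  have hset : {x | τ < ‖F x‖ₑ} = ⋃ n, {x | u n < ‖F x‖ₑ} := by
    ext x
    simp only [mem_ofPred_eq, mem_iUnion]
    refine ⟨fun hx => (hlim.eventually_lt_const hx).exists, ?_⟩
    rintro ⟨n, hn⟩
    exact (hlt n).1.trans hn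
  have hmono : Monotone fun n => {x | u n < ‖F x‖ₑ} := fun a b hab x hx =>
    (hu.antitone hab).trans_lt hx
  rw [hset, hmono.measure_iUnion]
  refine iSup_le fun n => ?_
  obtain ⟨v, hv, hvn⟩ := sInf_lt_iff.1 (h.trans_lt (hlt n).1)
  exact (measure_mono fun x hx => hvn.trans hx).trans hv

theorem antitone_decRearrangement {Ω : Type*} [MeasurableSpace Ω] (μ : Measure Ω) (F : Ω → ℝ) :
    Antitone (decRearrangement μ F) := fun _ _ h =>
  sInf_le_sInf fun _ hτ => le_trans hτ (ENNReal.ofReal_le_ofReal h)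

theorem volume_setOf_ofReal_lt (c : ℝ≥0∞) :
    volume.restrict (Ioi (0 : ℝ)) {s | ENNReal.ofReal s < c} = c := by
  rw [Measure.restrict_apply' measurableSet_Ioi]
  rcases eq_or_ne c ⊤ with rfl | hc
  · have : {s : ℝ | ENNReal.ofReal s < ⊤} ∩ Ioi 0 = Ioi 0 := by ext; simp
    rw [this, Real.volume_Ioi]
  · have : {s : ℝ | ENNReal.ofReal s < c} ∩ Ioi 0 = Ioo 0 c.toReal := by
      ext s
      simp only [mem_inter_iff, mem_ofPred_eq, mem_Ioi, mem_Ioo]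
      rw [and_comm]
      refine and_congr_right fun hs => ?_
      rw [ENNReal.ofReal_lt_iff_lt_toReal hs.le hc]
    rw [this, Real.volume_Ioo, sub_zero, ENNReal.ofReal_toReal hc]

/-- `F*` is equimeasurable with `|F|`. -/
theorem volume_lt_decRearrangement {Ω : Type*} [MeasurableSpace Ω] (μ : Measure Ω) (F : Ω → ℝ)
    (τ : ℝ≥0∞) :
    volume.restrict (Ioi (0 : ℝ)) {t | τ < decRearrangement μ F t} = μ {x | τ < ‖F x‖ₑ} := by
  rw [← volume_setOf_ofReal_lt (μ {x | τ < ‖F x‖ₑ})]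
  congr 1
  ext t
  simpa using (not_congr (decRearrangement_le_iff μ F t τ))

/-- The layer-cake formula for functions with values in `[0, ∞]`. -/
theorem lintegral_eq_lintegral_measure_ofReal_lt {Ω : Type*} [MeasurableSpace Ω]
    (μ : Measure Ω) [SFinite μ] {u : Ω → ℝ≥0∞} (hu : AEMeasurable u μ) :
    ∫⁻ x, u x ∂μ = ∫⁻ s in Ioi (0 : ℝ), μ {x | ENNReal.ofReal s < u x} := by
  wlog h : Measurable u generalizing u
  · rw [lintegral_congr_ae hu.ae_eq_mk, this hu.measurable_mk.aemeasurable hu.measurable_mk]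
    refine lintegral_congr fun s => measure_congr (Filter.eventuallyEq_set.2 ?_)
    filter_upwards [hu.ae_eq_mk] with x hx
    simp only [hx]
  have hm : MeasurableSet {z : Ω × ℝ | ENNReal.ofReal z.2 < u z.1} :=
    measurableSet_lt (by fun_prop) (by fun_prop)
  have h1 : ∀ x, u x = ∫⁻ s in Ioi (0 : ℝ),
      {z : Ω × ℝ | ENNReal.ofReal z.2 < u z.1}.indicator 1 (x, s) := fun x => by
    conv_lhs => rw [← volume_setOf_ofReal_lt (u x)]
    rw [← lintegral_indicator_one (measurableSet_lt (by fun_prop) (by fun_prop))]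
    rfl
  rw [lintegral_congr h1, lintegral_lintegral_swap (f := fun x s =>
    {z : Ω × ℝ | ENNReal.ofReal z.2 < u z.1}.indicator 1 (x, s))
    (measurable_one.indicator hm).aemeasurable]
  refine lintegral_congr fun s => ?_
  rw [← lintegral_indicator_one (measurableSet_lt (by fun_prop) (by fun_prop))]
  rfl

/-! ### Moments of the disjointification -/

/-- The distribution function of the disjointification is the sum of those of the `f k`. -/
theorem IsDisjointCopies.measure_lt_enorm_sum {n : ℕ} {f : Fin n → I → ℝ} {g : Fin n → ℝ → ℝ}
    (h : IsDisjointCopies f g) (τ : ℝ≥0∞) :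
    volume.restrict (Ioi (0 : ℝ)) {u | τ < ‖∑ k, g k u‖ₑ} =
      ∑ k, volume {x | τ < ‖f k x‖ₑ} := by
  have hs : MeasurableSet {y : ℝ | τ < ‖y‖ₑ} := measurableSet_lt (by fun_prop) (by fun_prop)
  have h0 : (0 : ℝ) ∉ {y : ℝ | τ < ‖y‖ₑ} := by simp
  have hne : ∀ {y : ℝ}, τ < ‖y‖ₑ → y ≠ 0 := fun hy h => h0 (h ▸ hy)
  have hdis : ∀ {i j u}, u ∈ Ioi (0 : ℝ) → g i u ≠ 0 → j ≠ i → g j u = 0 := by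
    intro i j u hu hi hj
    by_contra hc
    exact Set.disjoint_left.1 (h.disjoint j i hj) ⟨hc, hu⟩ ⟨hi, hu⟩
  have hsum : ∀ {i u}, u ∈ Ioi (0 : ℝ) → g i u ≠ 0 → ∑ k, g k u = g i u := fun hu hi =>
    Finset.sum_eq_single _ (fun j _ hj => hdis hu hi hj) (by simp)
  have heq : {u | τ < ‖∑ k, g k u‖ₑ} =ᵐ[volume.restrict (Ioi (0 : ℝ))]
      ⋃ k, g k ⁻¹' {y : ℝ | τ < ‖y‖ₑ} := by
    refine Filter.eventuallyEq_set.2 ?_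
    filter_upwards [ae_restrict_mem measurableSet_Ioi] with u hu
    simp only [mem_iUnion, mem_preimage, mem_ofPred_eq]
    constructor
    · intro hτ
      obtain ⟨i, -, hi⟩ := Finset.exists_ne_zero_of_sum_ne_zero (hne hτ)
      exact ⟨i, hsum hu hi ▸ hτ⟩
    · rintro ⟨i, hi⟩
      rwa [hsum hu (hne hi)]
  rw [measure_congr heq, measure_iUnion₀, tsum_fintype]
  · exact Finset.sum_congr rfl fun k _ => h.equimeasurable k _ hs h0
  · intro i j hij
    rw [Function.onFun, AEDisjoint, Measure.restrict_apply' measurableSet_Ioi]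
    convert measure_empty (μ := volume)
    refine Set.eq_empty_of_forall_notMem fun u hu => ?_
    exact hne hu.1.2 (hdis hu.2 (hne hu.1.1) hij.symm)
  · exact fun k => (h.aemeasurable k).nullMeasurableSet_preimage hs

theorem IsDisjointCopies.lintegral_decRearrangement_rpow {n : ℕ} {f : Fin n → I → ℝ}
    {g : Fin n → ℝ → ℝ} (h : IsDisjointCopies f g) (hf : ∀ k, AEMeasurable (f k)) {q : ℝ}
    (hq : 0 < q) :
    ∫⁻ t in Ioi (0 : ℝ),
        decRearrangement (volume.restrict (Ioi 0)) (fun u => ∑ k, g k u) t ^ q =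
      ∑ k, ∫⁻ x, ‖f k x‖ₑ ^ q := by
  have hlt : ∀ (s : ℝ) (a : ℝ≥0∞),
      ENNReal.ofReal s < a ^ q ↔ ENNReal.ofReal s ^ q⁻¹ < a := fun s a => by
    rw [ENNReal.rpow_inv_lt_iff hq]
  rw [lintegral_eq_lintegral_measure_ofReal_lt _
    ((antitone_decRearrangement _ _).measurable.pow_const q).aemeasurable]
  simp_rw [lintegral_eq_lintegral_measure_ofReal_lt volume ((hf _).enorm.pow_const q), hlt,
    volume_lt_decRearrangement, h.measure_lt_enorm_sum]
  refine lintegral_finsetSum _ fun k _ => Antitone.measurable fun a b hab => ?_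
  refine measure_mono fun x (hx : ENNReal.ofReal b ^ q⁻¹ < _) => ?_
  refine lt_of_le_of_lt ?_ hx
  gcongr

/-- Both moments of a decreasing function on `(0, ∞)` are controlled by its Rosenthal norm: on
`[1, ∞)` the function is at most `φ 1`, which is at most its `L_p` norm over `[0, 1]`. -/
theorem Antitone.lintegral_Ioi_le_and_lintegral_rpow_Ioi_le {φ : ℝ → ℝ≥0∞} (hφ : Antitone φ)
    {p : ℝ} (hp : 1 ≤ p) :
    ∫⁻ t in Ioi (0 : ℝ), φ t ≤ eLpNorm φ (ENNReal.ofReal p) (volume.restrict (Icc 0 1)) +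
      eLpNorm φ 1 (volume.restrict (Ici 1)) ∧
    ∫⁻ t in Ioi (0 : ℝ), φ t ^ p ≤
      (eLpNorm φ (ENNReal.ofReal p) (volume.restrict (Icc 0 1)) +
        eLpNorm φ 1 (volume.restrict (Ici 1))) ^ p := by
  have hp0 : 0 < p := by linarith
  have hm : Measurable φ := hφ.measurable
  set A := eLpNorm φ (ENNReal.ofReal p) (volume.restrict (Icc (0 : ℝ) 1)) with hA
  set B := eLpNorm φ 1 (volume.restrict (Ici (1 : ℝ))) with hB
  have hprob : IsProbabilityMeasure (volume.restrict (Icc (0 : ℝ) 1)) := ⟨by simp⟩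
  have hcover : Ioi (0 : ℝ) ⊆ Icc 0 1 ∪ Ici 1 := fun t (ht : 0 < t) => by
    rcases le_total t 1 with h | h
    · exact Or.inl ⟨ht.le, h⟩
    · exact Or.inr h
  have hsplit : ∀ ψ : ℝ → ℝ≥0∞, ∫⁻ t in Ioi (0 : ℝ), ψ t ≤
      (∫⁻ t in Icc (0 : ℝ) 1, ψ t) + ∫⁻ t in Ici (1 : ℝ), ψ t := fun ψ =>
    (lintegral_mono_set hcover).trans (lintegral_union_le ψ _ _)
  have hB' : B = ∫⁻ t in Ici (1 : ℝ), φ t := by simp [hB, eLpNorm_one_eq_lintegral_enorm]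
  have hA' : A ^ p = ∫⁻ t in Icc (0 : ℝ) 1, φ t ^ p := by
    rw [hA, eLpNorm_eq_lintegral_rpow_enorm_toReal (by simpa using hp0) ENNReal.ofReal_ne_top,
      ENNReal.toReal_ofReal hp0.le, one_div, ENNReal.rpow_inv_rpow hp0.ne']
    simp
  have hA1 : ∫⁻ t in Icc (0 : ℝ) 1, φ t ≤ A := by
    have := eLpNorm_le_eLpNorm_of_exponent_le (p := 1) (q := ENNReal.ofReal p)
      (μ := volume.restrict (Icc (0 : ℝ) 1)) (f := φ) (by simpa using hp)
      hm.aestronglyMeasurable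
    rw [eLpNorm_one_eq_lintegral_enorm] at this
    simpa using this
  have hφ1 : φ 1 ≤ A := by
    calc φ 1 = ∫⁻ _ in Icc (0 : ℝ) 1, φ 1 := by simp
      _ ≤ ∫⁻ t in Icc (0 : ℝ) 1, φ t := setLIntegral_mono hm fun t ht => hφ ht.2
      _ ≤ A := hA1
  have hpow : ∀ y : ℝ≥0∞, y ^ p = y ^ (p - 1) * y := fun y => by
    conv_lhs => rw [show p = (p - 1) + 1 by ring]
    rw [ENNReal.rpow_add_of_nonneg _ _ (by linarith) zero_le_one, ENNReal.rpow_one]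
  refine ⟨(hsplit φ).trans (add_le_add hA1 hB'.ge), (hsplit _).trans ?_⟩
  calc (∫⁻ t in Icc (0 : ℝ) 1, φ t ^ p) + ∫⁻ t in Ici (1 : ℝ), φ t ^ p
      ≤ A ^ p + ∫⁻ t in Ici (1 : ℝ), A ^ (p - 1) * φ t := by
        refine add_le_add hA'.ge ?_
        refine setLIntegral_mono (hm.const_mul _) fun t ht => ?_
        rw [hpow]
        gcongr
        exact (hφ ht).trans hφ1
    _ = A ^ (p - 1) * (A + B) := by rw [lintegral_const_mul _ hm, ← hB', hpow, mul_add]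
    _ ≤ (A + B) ^ (p - 1) * (A + B) := by
        gcongr
        exact le_self_add
    _ = _ := (hpow _).symm

/-! ### Moments of sums of independent random variables -/

/-- For `x ≤ 1` this is convexity of `y ↦ y ^ p`, and for `1 ≤ x` it follows from
`1 + r * x ≤ x * (1 + r)`. -/
theorem rpow_one_add_mul_le {p : ℝ} (hp : 1 ≤ p) {r P : ℝ≥0∞} (hr : (1 + r) ^ p ≤ 1 + P)
    (x : ℝ≥0∞) : (1 + r * x) ^ p ≤ 1 + (P * x + (1 + P) * x ^ p) := by
  rcases le_total x 1 with hx | hx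
  · have h := ENNReal.rpow_arith_mean_le_arith_mean2_rpow (1 - x) x 1 (1 + r)
      (tsub_add_cancel_of_le hx) hp
    have e : (1 - x) * 1 + x * (1 + r) = 1 + r * x := by
      rw [mul_one, mul_add, mul_one, ← add_assoc, tsub_add_cancel_of_le hx, mul_comm x r]
    rw [e] at h
    calc (1 + r * x) ^ p ≤ (1 - x) * 1 ^ p + x * (1 + r) ^ p := h
      _ ≤ (1 - x) * 1 ^ p + x * (1 + P) := by gcongr
      _ = 1 + P * x := by
        rw [ENNReal.one_rpow, mul_one, mul_add, mul_one, ← add_assoc, tsub_add_cancel_of_le hx,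
          mul_comm x P]
      _ ≤ _ := by gcongr; exact le_self_add
  · calc (1 + r * x) ^ p ≤ (x * (1 + r)) ^ p := by
          rw [mul_add, mul_one, mul_comm x r]; gcongr
      _ = (1 + r) ^ p * x ^ p := by
          rw [ENNReal.mul_rpow_of_nonneg _ _ (by linarith), mul_comm]
      _ ≤ (1 + P) * x ^ p := by gcongr
      _ ≤ _ := le_add_self.trans le_add_self

theorem one_add_sum_le_prod_one_add {ι : Type*} (s : Finset ι) (y : ι → ℝ≥0∞) :
    1 + ∑ k ∈ s, y k ≤ ∏ k ∈ s, (1 + y k) := by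
  classical
  induction s using Finset.induction_on with
  | empty => simp
  | insert a s ha ih =>
    rw [Finset.sum_insert ha, Finset.prod_insert ha]
    calc 1 + (y a + ∑ k ∈ s, y k) ≤ (1 + ∑ k ∈ s, y k) + y a * (1 + ∑ k ∈ s, y k) := by
          rw [mul_add, mul_one, add_left_comm, add_comm (y a), ← add_assoc]
          exact le_self_add
      _ = (1 + y a) * (1 + ∑ k ∈ s, y k) := by ring
      _ ≤ _ := by gcongr

/-- Independence enters through `(r ∑ X_k) ^ p ≤ ∏ (1 + r X_k) ^ p`, whose right side integrates
factor by factor; then `1 + b ≤ exp b` bounds the product by the exponential of a sum. -/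
theorem lintegral_rpow_mul_sum_le {Ω : Type*} [MeasurableSpace Ω] {μ : Measure Ω}
    [IsProbabilityMeasure μ] {n : ℕ} {X : Fin n → Ω → ℝ≥0∞} (hX : ∀ k, Measurable (X k))
    (hind : iIndepFun X μ) {p : ℝ} (hp : 1 ≤ p) {r : ℝ≥0∞}
    (hr : (1 + r) ^ p ≤ 1 + ENNReal.ofReal p)
    (h1 : ∑ k, ∫⁻ x, X k x ∂μ ≤ 1) (h2 : ∑ k, ∫⁻ x, X k x ^ p ∂μ ≤ 1) :
    ∫⁻ x, (r * ∑ k, X k x) ^ p ∂μ ≤ ENNReal.ofReal (Real.exp (3 * p)) := by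
  have hp0 : 0 < p := by linarith
  set P := ENNReal.ofReal p
  set b : Fin n → ℝ≥0∞ := fun k => P * ∫⁻ x, X k x ∂μ + (1 + P) * ∫⁻ x, X k x ^ p ∂μ
  have hb : ∑ k, b k ≤ ENNReal.ofReal (3 * p) := by
    calc ∑ k, b k = P * ∑ k, ∫⁻ x, X k x ∂μ + (1 + P) * ∑ k, ∫⁻ x, X k x ^ p ∂μ := by
          rw [Finset.sum_add_distrib, Finset.mul_sum, Finset.mul_sum]
      _ ≤ P * 1 + (1 + P) * 1 := by gcongr
      _ = ENNReal.ofReal (p + (1 + p)) := by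
          rw [ENNReal.ofReal_add hp0.le (by linarith), ENNReal.ofReal_add zero_le_one hp0.le]
          simp [P]
      _ ≤ _ := ENNReal.ofReal_le_ofReal (by linarith)
  have hbt : ∀ k, b k ≠ ⊤ := fun k => ne_top_of_le_ne_top ENNReal.ofReal_ne_top
    ((Finset.single_le_sum (fun _ _ => zero_le) (Finset.mem_univ k)).trans hb)
  calc ∫⁻ x, (r * ∑ k, X k x) ^ p ∂μ ≤ ∫⁻ x, ∏ k, (1 + r * X k x) ^ p ∂μ := by
        refine lintegral_mono fun x => ?_
        rw [ENNReal.prod_rpow_of_nonneg hp0.le, Finset.mul_sum]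
        gcongr
        exact le_add_self.trans (one_add_sum_le_prod_one_add Finset.univ _)
    _ = ∏ k, ∫⁻ x, (1 + r * X k x) ^ p ∂μ :=
        lintegral_prod_eq_prod_lintegral_of_indepFun _
          (fun k x => (1 + r * X k x) ^ p)
          (hind.comp (fun _ y => (1 + r * y) ^ p) (fun _ => by fun_prop)) (fun k => by fun_prop)
    _ ≤ ∏ k, (1 + b k) := by
        refine Finset.prod_le_prod' fun k _ => ?_
        calc ∫⁻ x, (1 + r * X k x) ^ p ∂μ
            ≤ ∫⁻ x, 1 + (P * X k x + (1 + P) * X k x ^ p) ∂μ :=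
              lintegral_mono fun x => rpow_one_add_mul_le hp hr _
          _ = 1 + b k := by
              have hm := hX k
              rw [lintegral_add_left measurable_const, lintegral_add_left (by fun_prop),
                lintegral_const_mul _ hm, lintegral_const_mul _ (by fun_prop)]
              simp [b]
    _ ≤ ∏ k, ENNReal.ofReal (Real.exp (b k).toReal) := by
        refine Finset.prod_le_prod' fun k _ => ?_
        rw [← ENNReal.ofReal_toReal (hbt k), ← ENNReal.ofReal_one,
          ← ENNReal.ofReal_add zero_le_one ENNReal.toReal_nonneg,
          ENNReal.toReal_ofReal ENNReal.toReal_nonneg]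
        refine ENNReal.ofReal_le_ofReal ?_
        linarith [Real.add_one_le_exp (b k).toReal]
    _ = ENNReal.ofReal (Real.exp (∑ k, b k).toReal) := by
        rw [← ENNReal.ofReal_prod_of_nonneg (fun _ _ => (Real.exp_pos _).le), ← Real.exp_sum,
          ENNReal.toReal_sum fun k _ => hbt k]
    _ ≤ _ := by
        gcongr
        exact ENNReal.toReal_le_of_le_ofReal (by positivity) hb

/-- Rosenthal's inequality for absolute values, with a constant of the order `p / log (p + 1)`. -/
theorem eLpNorm_sum_le_of_sum_lintegral_le {Ω : Type*} [MeasurableSpace Ω] {μ : Measure Ω}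
    [IsProbabilityMeasure μ] {n : ℕ} {f : Fin n → Ω → ℝ} (hf : ∀ k, AEMeasurable (f k) μ)
    (hind : iIndepFun f μ) {p : ℝ} (hp : 1 ≤ p) {M : ℝ≥0∞}
    (h1 : ∑ k, ∫⁻ x, ‖f k x‖ₑ ∂μ ≤ M) (h2 : ∑ k, ∫⁻ x, ‖f k x‖ₑ ^ p ∂μ ≤ M ^ p) :
    eLpNorm (fun x => ∑ k, f k x) (ENNReal.ofReal p) μ ≤
      ENNReal.ofReal (Real.exp 3 * (p / Real.log (p + 1))) * M := by
  have hp0 : 0 < p := by linarith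
  have hlog : 0 < Real.log (p + 1) := Real.log_pos (by linarith)
  set t := p / Real.log (p + 1)
  have ht : 0 < t := div_pos hp0 hlog
  wlog hmeas : ∀ k, Measurable (f k) generalizing f
  · have e : ∀ k, f k =ᵐ[μ] (hf k).mk (f k) := fun k => (hf k).ae_eq_mk
    have h1' : ∀ (q : ℝ) k, ∫⁻ x, ‖(hf k).mk (f k) x‖ₑ ^ q ∂μ = ∫⁻ x, ‖f k x‖ₑ ^ q ∂μ :=
      fun q k => lintegral_congr_ae ((e k).mono fun x hx => by simp only [hx])
    have := this (f := fun k => (hf k).mk (f k)) (fun k => (hf k).measurable_mk.aemeasurable)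
      (hind.congr e) ((Finset.sum_congr rfl fun k _ => by simpa using h1' 1 k).trans_le h1)
      ((Finset.sum_congr rfl fun k _ => h1' p k).trans_le h2) (fun k => (hf k).measurable_mk)
    rwa [eLpNorm_congr_ae (g := fun x => ∑ k, (hf k).mk (f k) x)]
    filter_upwards [ae_all_iff.2 e] with x hx
    simp only [hx]
  rcases eq_or_ne M ⊤ with rfl | hMt
  · rw [ENNReal.mul_top (by simpa using by positivity)]; exact le_top
  rcases eq_or_ne M 0 with rfl | hM0
  -- Normalising by `M` is impossible here, but every `f k` vanishes almost everywhere.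
  · have hz : ∀ k, f k =ᵐ[μ] 0 := fun k => by
      have : ∫⁻ x, ‖f k x‖ₑ ∂μ = 0 := by
        simpa using (Finset.sum_eq_zero_iff.1 (le_antisymm h1 zero_le)) k
      rw [lintegral_eq_zero_iff (hmeas k).enorm] at this
      filter_upwards [this] with x hx
      simpa using hx
    rw [eLpNorm_congr_ae (g := 0), eLpNorm_zero]
    · exact zero_le
    filter_upwards [ae_all_iff.2 hz] with x hx
    simp [hx]
  -- The scale `t` is chosen so that `(1 + 1 / t) ^ p ≤ exp (p / t) = p + 1`.
  set r := ENNReal.ofReal t⁻¹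
  have hr : (1 + r) ^ p ≤ 1 + ENNReal.ofReal p := by
    rw [← ENNReal.ofReal_one, ← ENNReal.ofReal_add zero_le_one (by positivity),
      ← ENNReal.ofReal_add zero_le_one hp0.le,
      ENNReal.ofReal_rpow_of_nonneg (by positivity) hp0.le]
    refine ENNReal.ofReal_le_ofReal ?_
    calc (1 + t⁻¹) ^ p ≤ (Real.exp t⁻¹) ^ p := by
          gcongr; linarith [Real.add_one_le_exp t⁻¹]
      _ = 1 + p := by
          rw [← Real.exp_mul, inv_div, div_mul_cancel₀ _ hp0.ne', Real.exp_log (by linarith),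
            add_comm]
  have hkey := lintegral_rpow_mul_sum_le (μ := μ) (X := fun k x => M⁻¹ * ‖f k x‖ₑ)
    (fun k => by have := hmeas k; fun_prop)
    (hind.comp (fun _ y => M⁻¹ * ‖y‖ₑ) (fun _ => by fun_prop)) hp hr
    (by
      simp_rw [lintegral_const_mul _ (hmeas _).enorm]
      rw [← Finset.mul_sum]
      exact (mul_le_mul_right h1 _).trans (ENNReal.inv_mul_cancel hM0 hMt).le)
    (by
      simp_rw [ENNReal.mul_rpow_of_nonneg _ _ hp0.le]
      simp_rw [lintegral_const_mul _ ((hmeas _).enorm.pow_const p)]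
      rw [← Finset.mul_sum]
      refine (mul_le_mul_right h2 _).trans ?_
      rw [← ENNReal.mul_rpow_of_nonneg _ _ hp0.le, ENNReal.inv_mul_cancel hM0 hMt,
        ENNReal.one_rpow])
  have hrt : r * ENNReal.ofReal t = 1 := by
    rw [← ENNReal.ofReal_mul (by positivity), inv_mul_cancel₀ ht.ne', ENNReal.ofReal_one]
  rw [eLpNorm_eq_lintegral_rpow_enorm_toReal (by simpa using hp0) ENNReal.ofReal_ne_top,
    ENNReal.toReal_ofReal hp0.le, one_div, ENNReal.rpow_inv_le_iff hp0]
  calc ∫⁻ x, ‖∑ k, f k x‖ₑ ^ p ∂μ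
      ≤ ∫⁻ x, (ENNReal.ofReal t * M) ^ p * (r * ∑ k, M⁻¹ * ‖f k x‖ₑ) ^ p ∂μ := by
        refine lintegral_mono fun x => ?_
        rw [← ENNReal.mul_rpow_of_nonneg _ _ hp0.le, ← Finset.mul_sum]
        have : ENNReal.ofReal t * M * (r * (M⁻¹ * ∑ k, ‖f k x‖ₑ)) = ∑ k, ‖f k x‖ₑ := by
          calc _ = (r * ENNReal.ofReal t) * (M⁻¹ * M) * ∑ k, ‖f k x‖ₑ := by ring
            _ = _ := by rw [hrt, ENNReal.inv_mul_cancel hM0 hMt, one_mul, one_mul]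
        rw [this]
        gcongr
        exact enorm_sum_le _ _
    _ ≤ (ENNReal.ofReal t * M) ^ p * ENNReal.ofReal (Real.exp (3 * p)) := by
        rw [lintegral_const_mul _ (by have := hmeas; fun_prop)]
        gcongr
    _ = _ := by
        rw [Real.exp_mul, ← ENNReal.ofReal_rpow_of_nonneg (Real.exp_pos _).le hp0.le,
          ← ENNReal.mul_rpow_of_nonneg _ _ hp0.le, ENNReal.ofReal_mul (Real.exp_pos _).le]
        congr 1
        ring

/-! ### Admissibility of a constant of order `p / log (p + 1)` -/

theorem isRosenthalConstant_exp_three_mul {p : ℝ} (hp : 1 ≤ p) :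
    IsRosenthalConstant p (Real.exp 3 * (p / Real.log (p + 1))) := by
  have hlog : 0 < Real.log (p + 1) := Real.log_pos (by linarith)
  refine ⟨by positivity, fun n f g hf hind hg => ?_⟩
  have hm : ∀ k, AEMeasurable (f k) := fun k => (hf k).aestronglyMeasurable.aemeasurable
  obtain ⟨h1, h2⟩ := (antitone_decRearrangement (volume.restrict (Ioi 0))
    (fun u => ∑ k, g k u)).lintegral_Ioi_le_and_lintegral_rpow_Ioi_le hp
  refine eLpNorm_sum_le_of_sum_lintegral_le hm hind hp ?_ ?_
  · have := hg.lintegral_decRearrangement_rpow hm one_pos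
    simp only [ENNReal.rpow_one] at this
    exact this ▸ h1
  · have := hg.lintegral_decRearrangement_rpow hm (zero_lt_one.trans_le hp)
    exact this ▸ h2

/-! ### Independent indicators and the lower bound -/

/-- `[0, 1]` carries any finite number of independent uniformly distributed variables, because the
cube `[0, 1]^m` with its product measure is an image of it. -/
theorem exists_indep_uniform (m : ℕ) :
    ∃ φ : Fin m → I → I, (∀ k, Measurable (φ k)) ∧ (∀ k, volume.map (φ k) = volume) ∧
      iIndepFun φ volume := by
  obtain ⟨φ, hφ, hmap⟩ :=
    Measure.exists_measurable_map_eq (Measure.pi fun _ : Fin m => (volume : Measure I))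
  have hk : ∀ k, Measurable fun x => φ x k := fun k => (measurable_pi_apply k).comp hφ
  have hlaw : ∀ k, volume.map (fun x => φ x k) = volume := fun k => by
    have h := (measurePreserving_eval (fun _ : Fin m => (volume : Measure I)) k).map_eq
    rwa [← hmap, Measure.map_map (measurable_pi_apply k) hφ] at h
  refine ⟨fun k x => φ x k, hk, hlaw, ?_⟩
  rw [iIndepFun_iff_map_fun_eq_pi_map fun k => (hk k).aemeasurable]
  simp_rw [hlaw]
  exact hmap

theorem rosenthalNorm_indicator_le_one {p : ℝ} (hp : 1 ≤ p) {F : ℝ → ℝ}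
    (hF : ∀ u ∈ Ioi (0 : ℝ), F u = (Ioc 0 1).indicator 1 u) : rosenthalNorm p F ≤ 1 := by
  have hprob : IsProbabilityMeasure (volume.restrict (Icc (0 : ℝ) 1)) := ⟨by simp⟩
  have hle1 : ∀ t, decRearrangement (volume.restrict (Ioi 0)) F t ≤ 1 := fun t => by
    rw [decRearrangement_le_iff, Measure.restrict_apply' measurableSet_Ioi]
    have : {u | 1 < ‖F u‖ₑ} ∩ Ioi 0 = ∅ := by
      refine Set.eq_empty_of_forall_notMem fun u hu => ?_
      have h1 : 1 < ‖F u‖ₑ := hu.1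
      rw [hF u hu.2] at h1
      by_cases h : u ∈ Ioc (0 : ℝ) 1 <;> simp [h] at h1
    simp [this]
  have hle0 : ∀ t ∈ Ici (1 : ℝ), decRearrangement (volume.restrict (Ioi 0)) F t = 0 :=
      fun t ht => by
    rw [← nonpos_iff_eq_zero, decRearrangement_le_iff, Measure.restrict_apply' measurableSet_Ioi]
    calc volume ({u | 0 < ‖F u‖ₑ} ∩ Ioi 0) ≤ volume (Ioc (0 : ℝ) 1) := by
          refine measure_mono fun u hu => ?_
          have h1 : 0 < ‖F u‖ₑ := hu.1
          rw [hF u hu.2] at h1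
          by_contra h
          simp [h] at h1
      _ ≤ ENNReal.ofReal t := by simpa using ht
  have h1 : eLpNorm (decRearrangement (volume.restrict (Ioi 0)) F) (ENNReal.ofReal p)
      (volume.restrict (Icc 0 1)) ≤ 1 := by
    refine (eLpNorm_mono_enorm (g := fun _ => (1 : ℝ≥0∞)) fun t => by simpa using hle1 t).trans ?_
    rw [eLpNorm_const _ (by simpa using by linarith) (NeZero.ne _)]
    simp
  have h2 : eLpNorm (decRearrangement (volume.restrict (Ioi 0)) F) 1
      (volume.restrict (Ici 1)) = 0 := by
    rw [eLpNorm_one_eq_lintegral_enorm, setLIntegral_congr_fun measurableSet_Ici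
      (g := fun _ => 0) fun t ht => by simp [hle0 t ht]]
    simp
  rw [rosenthalNorm, h2, add_zero]
  exact h1

theorem indicator_one_preimage_of_zero_notMem {α : Type*} (s : Set α) {B : Set ℝ}
    (hB : (0 : ℝ) ∉ B) [Decidable ((1 : ℝ) ∈ B)] :
    s.indicator (1 : α → ℝ) ⁻¹' B = if (1 : ℝ) ∈ B then s else ∅ := by
  ext x
  by_cases hx : x ∈ s <;> by_cases h1 : (1 : ℝ) ∈ B <;> simp [hx, hB, h1]

/-- Indicators of events of probability `1 / m` are copied onto the consecutive intervals
`(k / m, (k + 1) / m]`, which fill `(0, 1]`. -/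
theorem isDisjointCopies_indicator {m : ℕ} {s : Fin m → Set I}
    (hs : ∀ k, volume (s k) = ENNReal.ofReal (1 / m)) :
    IsDisjointCopies (fun k => (s k).indicator 1)
      (fun k => (Ioc ((k : ℝ) / m) ((k + 1) / m)).indicator 1) where
  aemeasurable k := (measurable_one.indicator measurableSet_Ioc).aemeasurable
  disjoint i j hij := by
    have hm : (0 : ℝ) < m := by exact_mod_cast (Nat.zero_le _).trans_lt i.2
    refine Set.disjoint_left.2 fun u hi hj => hij ?_
    have hi := hi.1
    have hj := hj.1
    rw [Function.mem_support, indicator_apply_ne_zero] at hi hj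
    have hi := hi.1
    have hj := hj.1
    rw [mem_Ioc, div_lt_iff₀ hm, le_div_iff₀ hm] at hi hj
    have h1 : (i : ℝ) < j + 1 := by linarith
    have h2 : (j : ℝ) < i + 1 := by linarith
    norm_cast at h1 h2
    omega
  equimeasurable k B _ h0 := by
    classical
    rw [indicator_one_preimage_of_zero_notMem _ h0, indicator_one_preimage_of_zero_notMem _ h0]
    split_ifs
    · have : Ioc ((k : ℝ) / m) ((k + 1) / m) ∩ Ioi 0 = Ioc ((k : ℝ) / m) ((k + 1) / m) :=
        inter_eq_left.2 fun u hu => lt_of_le_of_lt (by positivity) hu.1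
      rw [Measure.restrict_apply' measurableSet_Ioi, this, Real.volume_Ioc, hs]
      congr 1
      ring
    · simp

theorem sum_indicator_Ioc_div {m : ℕ} (hm : 0 < m) (u : ℝ) :
    ∑ k : Fin m, (Ioc ((k : ℝ) / m) ((k + 1) / m)).indicator (1 : ℝ → ℝ) u =
      (Ioc 0 1).indicator 1 u := by
  have hm' : (0 : ℝ) < m := by exact_mod_cast hm
  have key : ∀ n : ℕ, ∑ k ∈ Finset.range n,
      (Ioc ((k : ℝ) / m) ((k + 1) / m)).indicator (1 : ℝ → ℝ) u =
        (Ioc 0 ((n : ℝ) / m)).indicator 1 u := by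
    intro n
    induction n with
    | zero => simp
    | succ n ih =>
      have h0 : (0 : ℝ) ≤ n / m := by positivity
      have h1 : (n : ℝ) / m ≤ (n + 1) / m := by gcongr; linarith
      rw [Finset.sum_range_succ, ih, Nat.cast_succ, ← Ioc_union_Ioc_eq_Ioc h0 h1,
        indicator_union_of_disjoint (Ioc_disjoint_Ioc_of_le le_rfl)]
  rw [Fin.sum_univ_eq_sum_range
    (fun k => (Ioc ((k : ℝ) / m) ((k + 1) / m)).indicator (1 : ℝ → ℝ) u), key, div_self hm'.ne']

/-- Test on `m` independent events of probability `1 / m`: the disjointification is the indicator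
of `(0, 1]`, while the sum equals `m` with probability at least `m ^ (-m)`. -/
theorem IsRosenthalConstant.rpow_mul_pow_le {p C : ℝ} (hp : 1 ≤ p) (hC : IsRosenthalConstant p C)
    {m : ℕ} (hm : 0 < m) : (m : ℝ) ^ p * (1 / m) ^ m ≤ C ^ p := by
  have hp0 : 0 < p := by linarith
  have hm1 : (1 : ℝ) ≤ m := by exact_mod_cast hm
  obtain ⟨φ, hφ, hlaw, hind⟩ := exists_indep_uniform m
  set c : I := ⟨1 / m, by positivity, by rw [div_le_one (by linarith)]; exact hm1⟩
  have hs : ∀ k, volume (φ k ⁻¹' Iic c) = ENNReal.ofReal (1 / m) := fun k => by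
    rw [← Measure.map_apply (hφ k) measurableSet_Iic, hlaw, unitInterval.volume_Iic]
  have hfm : ∀ k, Measurable ((φ k ⁻¹' Iic c).indicator (1 : I → ℝ)) := fun k =>
    measurable_one.indicator (hφ k measurableSet_Iic)
  have hmain := hC.2 m (fun k => (φ k ⁻¹' Iic c).indicator 1) _
    (fun k => MemLp.of_bound (hfm k).aestronglyMeasurable 1
      (Filter.Eventually.of_forall fun x => by
        by_cases hx : x ∈ φ k ⁻¹' Iic c <;> simp [indicator, hx]))
    (hind.comp (fun _ => (Iic c).indicator (1 : I → ℝ))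
      fun _ => measurable_one.indicator measurableSet_Iic)
    (isDisjointCopies_indicator hs)
  have hle := hmain.trans (mul_le_mul_right
    (rosenthalNorm_indicator_le_one hp fun u _ => sum_indicator_Ioc_div hm u) _)
  rw [mul_one] at hle
  have hcheb := mul_meas_ge_le_pow_eLpNorm' (volume : Measure I) (p := ENNReal.ofReal p)
    (by simpa using hp0) ENNReal.ofReal_ne_top
    (f := fun x => ∑ k, (φ k ⁻¹' Iic c).indicator (1 : I → ℝ) x)
    (Finset.measurable_fun_sum _ fun k _ => hfm k).aestronglyMeasurable (ENNReal.ofReal m)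
  rw [ENNReal.toReal_ofReal hp0.le] at hcheb
  have hall : ENNReal.ofReal ((1 / m) ^ m) ≤
      volume {x | ENNReal.ofReal m ≤ ‖∑ k, (φ k ⁻¹' Iic c).indicator (1 : I → ℝ) x‖ₑ} := by
    have hinter := hind.meas_iInter (s := fun k => φ k ⁻¹' Iic c)
      fun k => ⟨Iic c, measurableSet_Iic, rfl⟩
    simp only [hs, Finset.prod_const, Finset.card_univ, Fintype.card_fin] at hinter
    rw [ENNReal.ofReal_pow (by positivity), ← hinter]
    refine measure_mono fun x hx => ?_
    rw [mem_iInter] at hx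
    have hsum : ∑ k, (φ k ⁻¹' Iic c).indicator (1 : I → ℝ) x = m := by
      rw [Finset.sum_congr rfl fun k _ => indicator_of_mem (hx k) 1]
      simp
    change _ ≤ ‖_‖ₑ
    rw [hsum, Real.enorm_eq_ofReal (by positivity)]
  have hfinal : ENNReal.ofReal ((m : ℝ) ^ p * (1 / m) ^ m) ≤ ENNReal.ofReal (C ^ p) := by
    rw [ENNReal.ofReal_mul (by positivity),
      ← ENNReal.ofReal_rpow_of_nonneg (by positivity) hp0.le,
      ← ENNReal.ofReal_rpow_of_nonneg hC.1.le hp0.le]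
    calc _ ≤ _ := mul_le_mul_right hall _
      _ ≤ _ := hcheb
      _ ≤ _ := by gcongr
  exact (ENNReal.ofReal_le_ofReal_iff (Real.rpow_nonneg hC.1.le _)).1 hfinal

theorem IsRosenthalConstant.le {p C : ℝ} (hp : 1 ≤ p) (hC : IsRosenthalConstant p C) :
    (2 * Real.exp 1)⁻¹ * (p / Real.log (p + 1)) ≤ C := by
  have hp0 : 0 < p := by linarith
  have hlog : 0 < Real.log (p + 1) := Real.log_pos (by linarith)
  set t := p / Real.log (p + 1) with ht
  have ht1 : 1 ≤ t := by
    rw [ht, one_le_div hlog]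
    linarith [Real.log_le_sub_one_of_pos (show 0 < p + 1 by linarith)]
  set m := ⌊t⌋₊
  have hm : 0 < m := Nat.floor_pos.2 ht1
  have hm0 : (0 : ℝ) < m := by exact_mod_cast hm
  have hm1 : (1 : ℝ) ≤ m := by exact_mod_cast hm
  have hmt : (m : ℝ) ≤ t := Nat.floor_le (by linarith)
  have htm : t ≤ 2 * m := by linarith [Nat.lt_floor_add_one t]
  -- With `m ≤ t ≤ p + 1`, the probability `m ^ (-m)` is at least
  -- `exp (-t * log (p + 1)) = exp (-p)`.
  have htp : t ≤ p + 1 := by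
    rw [ht, div_le_iff₀ hlog]
    have h := Real.one_sub_inv_le_log_of_pos (show 0 < p + 1 by linarith)
    have h2 : (p + 1) * (1 - (p + 1)⁻¹) = p := by field_simp; ring
    nlinarith
  have hmlog : m * Real.log m ≤ p := by
    calc m * Real.log m ≤ t * Real.log (p + 1) := by
          gcongr
          exact hmt.trans htp
      _ = p := div_mul_cancel₀ _ hlog.ne'
  have hexp : Real.exp (-1) ^ p ≤ (1 / (m : ℝ)) ^ m := by
    rw [← Real.exp_mul, one_div, inv_pow, ← Real.exp_log (pow_pos hm0 m), ← Real.exp_neg,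
      Real.log_pow]
    gcongr
    linarith
  have hpow : (m * Real.exp (-1)) ^ p ≤ C ^ p := by
    rw [Real.mul_rpow hm0.le (Real.exp_pos _).le]
    exact (mul_le_mul_of_nonneg_left hexp (by positivity)).trans (hC.rpow_mul_pow_le hp hm)
  have hmC := (Real.rpow_le_rpow_iff (by positivity) hC.1.le hp0).1 hpow
  calc (2 * Real.exp 1)⁻¹ * t ≤ (2 * Real.exp 1)⁻¹ * (2 * m) := by gcongr
    _ = m * Real.exp (-1) := by rw [Real.exp_neg]; field_simp
    _ ≤ C := hmC

theorem corollary4p6 :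
    ∃ α β : ℝ, 0 < α ∧ 0 < β ∧ ∀ p : ℝ, 1 ≤ p →
      IsRosenthalConstant p (β * (p / Real.log (p + 1))) ∧
      ∀ C : ℝ, IsRosenthalConstant p C → α * (p / Real.log (p + 1)) ≤ C :=
  ⟨(2 * Real.exp 1)⁻¹, Real.exp 3, by positivity, by positivity, fun _ hp =>
    ⟨isRosenthalConstant_exp_three_mul hp, fun _ hC => hC.le hp⟩⟩
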